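/- Let $\mathbb T^d=\mathbb R^d/\mathbb Z^d$ be the standard flat torus, write $\|x-y\|$ for the flat distance, let $L\subset\mathbb T^d$ be finite and $W\subset\mathbb T^d$. A set $S\subset \mathbb T^d$ is an $\varepsilon$-sample if every $x\in\mathbb T^d$ satisfies $\|s-x\|<\varepsilon$ for some $s\in S$. The set $L$ is a $(\lambda,\bar\mu)$-net if it is a $\lambda$-sample and $\|p-q\|\ge\bar\mu\lambda$ for all distinct $p,q\in L$. A simplex is a nonempty finite set $\sigma\subseteq L$; it is a $d$-simplex if it has $d+1$ elements, and its faces are its nonempty subsets. A Delaunay center of $\sigma$ is a point $x\in\mathbb T^d$ with $\|p-x\|\le\|q-x\|$ for all $p\in\sigma$, $q\in L$; the Delaunay complex $\mathrm{Del}(L)$ consists of the simplices that have a Delaunay center. A witness of $\sigma$ is a point $w$ with $\|w-p\|\le\|w-q\|$ for all $p\in\sigma$, $q\in L\setminus\sigma$; the witness complex $\mathrm{Wit}(L,W)$ consists of the simplices $\sigma$ all of whose faces ($\sigma$ included) have a witness in $W$. A simplex $\sigma$ is $\delta$-protected if it has a Delaunay center $x$ with $\|x-q\|>\|x-p\|+\delta$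 for all $p\in\sigma$, $q\in L\setminus\sigma$. For a family $K$ of simplices of a complex $X$, $\mathrm{star}(K;X)$ is the set of simplices of $X$ having at least one vertex among the vertices of simplices of $K$; $\mathrm{star}(p;X)$ is the set of simplices of $X$ containing $p$, and $\mathrm{star}^2(p)=\mathrm{star}(\mathrm{star}(p;\mathrm{Del}(L));\mathrm{Del}(L))$. **Lemma (Identity from protection).** Let $L$ be a $(\lambda,\bar\mu)$-net with $\lambda\le 1/4$ and $\bar\mu>0$, and let $p\in L$. Suppose that every $d$-simplex in $\mathrm{star}^2(p)$ is $\delta$-protected and that $W$ is an $\varepsilon$-sample of $\mathbb T^d$, where $\delta\ge 8d\varepsilon/\bar\mu$. Then $$\mathrm{star}(p;\mathrm{Del}(L))\subseteq\mathrm{star}(p;\mathrm{Wit}(L,W)),$$ and if moreover $\lambda\le 1/6$, then $$\mathrm{star}(p;\mathrm{Wit}(L,W))=\mathrm{star}(p;\mathrm{Del}(L)).$$ -/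

import Mathlib

/-- The integer lattice `ℤ^d` inside Euclidean space `ℝ^d`. -/
def integerLattice (d : ℕ) : AddSubgroup (EuclideanSpace ℝ (Fin d)) where
  carrier := {x | ∀ i, ∃ n : ℤ, x i = (n : ℝ)}
  zero_mem' := fun _ => ⟨0, by simp⟩
  add_mem' := by
    intro x y hx hy i
    obtain ⟨m, hm⟩ := hx i
    obtain ⟨n, hn⟩ := hy i
    exact ⟨m + n, by simp [hm, hn]⟩
  neg_mem' := by
    intro x hx i
    obtain ⟨m, hm⟩ := hx i
    exact ⟨-m, by simp [hm]⟩

/-- The standard flat torus `ℝ^d / ℤ^d`. Mathlib equips it with the quotient norm, so that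
`‖x - y‖` is the infimum of the Euclidean distances between representatives of `x` and `y`. -/
abbrev FlatTorus (d : ℕ) : Type :=
  EuclideanSpace ℝ (Fin d) ⧸ integerLattice d

namespace FlatTorus

variable {d : ℕ}

/-- `S` is an `ε`-sample of the torus: every point is at distance less than `ε` from `S`. -/
def IsSample (S : Set (FlatTorus d)) (ε : ℝ) : Prop :=
  ∀ x : FlatTorus d, ∃ s ∈ S, ‖s - x‖ < ε

/-- `L` is a `(lam, mu)`-net: a `lam`-sample whose distinct points are at distance at least
`mu * lam`. -/
structure IsNet (L : Finset (FlatTorus d)) (lam mu : ℝ) : Prop where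
  sample : IsSample (L : Set (FlatTorus d)) lam
  separated : ∀ p ∈ L, ∀ q ∈ L, p ≠ q → mu * lam ≤ ‖p - q‖

/-- `x` is a Delaunay center of `σ` with respect to `L`. -/
def IsDelaunayCenter (L σ : Finset (FlatTorus d)) (x : FlatTorus d) : Prop :=
  ∀ p ∈ σ, ∀ q ∈ L, ‖p - x‖ ≤ ‖q - x‖

/-- The Delaunay complex of `L`: the nonempty `σ ⊆ L` that have a Delaunay center. -/
def delaunayComplex (L : Finset (FlatTorus d)) : Set (Finset (FlatTorus d)) :=
  {σ | σ.Nonempty ∧ σ ⊆ L ∧ ∃ x, IsDelaunayCenter L σ x}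

/-- `w` is a (weak) witness of `σ` with respect to `L`. -/
def IsWitness (L σ : Finset (FlatTorus d)) (w : FlatTorus d) : Prop :=
  ∀ p ∈ σ, ∀ q ∈ L, q ∉ σ → ‖w - p‖ ≤ ‖w - q‖

/-- The witness complex of `L` and `W`: the nonempty `σ ⊆ L` all of whose faces, `σ` included,
have a witness in `W`. -/
def witnessComplex (L : Finset (FlatTorus d)) (W : Set (FlatTorus d)) :
    Set (Finset (FlatTorus d)) :=
  {σ | σ.Nonempty ∧ σ ⊆ L ∧ ∀ τ : Finset (FlatTorus d), τ.Nonempty → τ ⊆ σ →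
    ∃ w ∈ W, IsWitness L τ w}

/-- `σ` is `δ`-protected at `x` with respect to `L`. -/
def IsProtectedAt (L σ : Finset (FlatTorus d)) (δ : ℝ) (x : FlatTorus d) : Prop :=
  ∀ p ∈ σ, ∀ q ∈ L, q ∉ σ → ‖x - p‖ + δ < ‖x - q‖

/-- `σ` has a `δ`-protected Delaunay center. -/
def IsProtected (L σ : Finset (FlatTorus d)) (δ : ℝ) : Prop :=
  ∃ x, IsDelaunayCenter L σ x ∧ IsProtectedAt L σ δ x

/-- The star of `K` in the complex `X`: all simplices of `X` with at least one vertex in `K`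
(that is, a vertex belonging to some simplex of `K`). -/
def star (K X : Set (Finset (FlatTorus d))) : Set (Finset (FlatTorus d)) :=
  {σ | σ ∈ X ∧ ∃ v ∈ σ, ∃ τ ∈ K, v ∈ τ}

/-- The star of the vertex `p` in the complex `X`. -/
def vertexStar (p : FlatTorus d) (X : Set (Finset (FlatTorus d))) :
    Set (Finset (FlatTorus d)) :=
  star {{p}} X

/-- The star of the star of the vertex `p`, both taken in the Delaunay complex of `L`. -/
def star2 (L : Finset (FlatTorus d)) (p : FlatTorus d) : Set (Finset (FlatTorus d)) :=
  star (vertexStar p (delaunayComplex L)) (delaunayComplex L)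

end FlatTorus

/-! Everything is lifted to `ℝ^d`, where `L` becomes a locally finite periodic set. The bounds on
`lam` ensure that two lifts of one point, if both near the simplex at hand, coincide.

Delaunay to witness: let `τ` be a face of a simplex of the star of `p`, and `v` a vertex of `τ`. All
Delaunay `d`-simplices at `v` lie in `star2 L p`, hence are protected. The Voronoi face dual to `τ`
is compact and convex. At an extreme point `c` the nearest lifts affinely span, and protection makes
them exactly `d + 1` points, with all other landmarks farther by `δ`
(`exists_nearest_simplex_of_mem_extremePoints`). Fix one extreme point `c₀` with nearest set `N`.
For each `s ∈ N` outside the lifted `τ`, some extreme point has `s` strictly farther than `v`, hence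
farther by `δ`. In the average of these `d + 1` centers every landmark outside `τ` is protected at
one term at least. Differences of squared distances are affine in the center, so the average is `2 *
ε`-protected (`norm_average_sub_add_le`), and a point of `W` within `ε` of it is a witness of `τ`.

Witness to Delaunay: witnessed edges are shorter than `2 * lam`, so the simplex and its witnesses
lift consistently, and de Silva's theorem (`voronoiFace_nonempty_of_witnesses`), proved by
separating a convex cone from a point, gives a Delaunay center. -/

namespace FlatTorus

variable {d : ℕ}

/-! ### Lifting from the torus to Euclidean space -/

/-- The projection `ℝ^d → ℝ^d / ℤ^d`. -/
def proj : EuclideanSpace ℝ (Fin d) →+ FlatTorus d :=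
  QuotientAddGroup.mk' (integerLattice d)

/-- The periodic set of all lifts of points of `L`. -/
def lifts (L : Finset (FlatTorus d)) : Set (EuclideanSpace ℝ (Fin d)) :=
  {x | proj x ∈ L}

theorem mem_lifts {L : Finset (FlatTorus d)} {x : EuclideanSpace ℝ (Fin d)} :
    x ∈ lifts L ↔ proj x ∈ L := Iff.rfl

theorem proj_surjective : Function.Surjective (proj (d := d)) :=
  QuotientAddGroup.mk'_surjective _

theorem norm_proj_le (x : EuclideanSpace ℝ (Fin d)) : ‖proj x‖ ≤ ‖x‖ :=
  QuotientAddGroup.norm_mk_le_norm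

theorem norm_proj_sub_le (x y : EuclideanSpace ℝ (Fin d)) : ‖proj x - proj y‖ ≤ ‖x - y‖ := by
  rw [← map_sub]
  exact norm_proj_le _

/-- A point close to `proj x` has a lift equally close to `x`. -/
theorem exists_lift_of_norm_sub_lt {x : EuclideanSpace ℝ (Fin d)} {y : FlatTorus d} {r : ℝ}
    (h : ‖y - proj x‖ < r) : ∃ y', proj y' = y ∧ ‖y' - x‖ < r := by
  obtain ⟨m, hm, hr⟩ := QuotientAddGroup.norm_lt_iff.1 h
  refine ⟨m + x, ?_, by simpa using hr⟩
  rw [map_add]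
  exact eq_sub_iff_add_eq.1 hm

theorem le_norm_proj_sub {x : EuclideanSpace ℝ (Fin d)} {y : FlatTorus d} {r : ℝ}
    (h : ∀ y', proj y' = y → r ≤ ‖x - y'‖) : r ≤ ‖proj x - y‖ := by
  by_contra hlt
  rw [not_le, norm_sub_rev] at hlt
  obtain ⟨y', hy', hr⟩ := exists_lift_of_norm_sub_lt hlt
  have := h y' hy'
  rw [norm_sub_rev] at this
  linarith

theorem one_le_norm_of_mem_integerLattice {x : EuclideanSpace ℝ (Fin d)}
    (hx : x ∈ integerLattice d) (h0 : x ≠ 0) : 1 ≤ ‖x‖ := by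
  obtain ⟨i, hi⟩ : ∃ i, x i ≠ 0 := by
    by_contra! h
    exact h0 (by ext i; simpa using h i)
  obtain ⟨n, hn⟩ := hx i
  have hn0 : n ≠ 0 := by
    rintro rfl
    exact hi (by simpa using hn)
  calc (1 : ℝ) ≤ |(n : ℝ)| := by exact_mod_cast Int.one_le_abs hn0
    _ = ‖x i‖ := by rw [hn, Real.norm_eq_abs]
    _ ≤ ‖x‖ := PiLp.norm_apply_le x i

theorem sub_mem_integerLattice {x y : EuclideanSpace ℝ (Fin d)} (h : proj x = proj y) :
    x - y ∈ integerLattice d := by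
  have h' : proj (x - y) = 0 := by rw [map_sub, h, sub_self]
  exact (QuotientAddGroup.eq_zero_iff _).1 h'

theorem one_le_norm_sub {x y : EuclideanSpace ℝ (Fin d)} (h : proj x = proj y) (hne : x ≠ y) :
    1 ≤ ‖x - y‖ :=
  one_le_norm_of_mem_integerLattice (sub_mem_integerLattice h) (sub_ne_zero.2 hne)

theorem eq_of_proj_eq {x y : EuclideanSpace ℝ (Fin d)} (h : proj x = proj y)
    (hlt : ‖x - y‖ < 1) : x = y := by
  by_contra hne
  exact absurd (one_le_norm_sub h hne) (not_le.2 hlt)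

/-- The projection is isometric at scales at most `1 / 2`. -/
theorem norm_proj_sub_eq {x y : EuclideanSpace ℝ (Fin d)} (h : ‖x - y‖ ≤ 1 / 2) :
    ‖proj x - proj y‖ = ‖x - y‖ := by
  refine le_antisymm (norm_proj_sub_le x y) (le_norm_proj_sub fun y' hy' => ?_)
  by_cases hne : y' = y
  · rw [hne]
  · have h1 := one_le_norm_sub hy' hne
    have h2 : ‖y' - y‖ ≤ ‖x - y'‖ + ‖x - y‖ := by
      rw [norm_sub_rev x y']
      exact norm_sub_le_norm_sub_add_norm_sub y' x y
    linarith

theorem exists_mem_lifts_norm_sub_lt {L : Finset (FlatTorus d)} {r : ℝ}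
    (hL : IsSample (L : Set (FlatTorus d)) r) (x : EuclideanSpace ℝ (Fin d)) :
    ∃ a ∈ lifts L, ‖a - x‖ < r := by
  obtain ⟨s, hs, hr⟩ := hL (proj x)
  obtain ⟨a, rfl, ha⟩ := exists_lift_of_norm_sub_lt hr
  exact ⟨a, hs, ha⟩

theorem finite_integerLattice_inter_closedBall (r : ℝ) :
    ((integerLattice d : Set (EuclideanSpace ℝ (Fin d))) ∩ Metric.closedBall 0 r).Finite := by
  have hfin : (Set.pi Set.univ fun _ : Fin d => Set.Icc (-⌈r⌉) ⌈r⌉).Finite :=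
    Set.Finite.pi fun _ => Set.finite_Icc _ _
  refine (hfin.image fun n => WithLp.toLp 2 fun i => (n i : ℝ)).subset ?_
  rintro x ⟨hx, hr⟩
  choose n hn using hx
  refine ⟨n, fun i _ => ?_, ?_⟩
  · have h1 : |(n i : ℝ)| ≤ r := by
      rw [← hn i, ← Real.norm_eq_abs]
      exact (PiLp.norm_apply_le x i).trans (by simpa using hr)
    have h2 : |(n i : ℝ)| ≤ (⌈r⌉ : ℝ) := h1.trans (Int.le_ceil r)
    exact abs_le.1 (by exact_mod_cast h2)
  · ext i
    exact (hn i).symm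

theorem finite_lifts_inter_closedBall (L : Finset (FlatTorus d)) (x : EuclideanSpace ℝ (Fin d))
    (r : ℝ) : (lifts L ∩ Metric.closedBall x r).Finite := by
  choose g hg using proj_surjective (d := d)
  have : lifts L ∩ Metric.closedBall x r ⊆ ⋃ l ∈ L, (fun z => z + g l) ''
      ((integerLattice d : Set (EuclideanSpace ℝ (Fin d))) ∩
        Metric.closedBall 0 (r + ‖x - g l‖)) := by
    rintro y ⟨hy, hr⟩
    simp only [Set.mem_iUnion]
    refine ⟨proj y, hy, y - g (proj y), ⟨sub_mem_integerLattice (hg _).symm, ?_⟩, by simp⟩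
    rw [mem_closedBall_zero_iff]
    rw [mem_closedBall_iff_norm] at hr
    exact (norm_sub_le_norm_sub_add_norm_sub y x _).trans (by gcongr)
  refine Set.Finite.subset ?_ this
  exact L.finite_toSet.biUnion fun l _ => (finite_integerLattice_inter_closedBall _).image _

end FlatTorus

/-! ### De Silva's weak witness theorem -/

open scoped RealInnerProductSpace

/-- The admissible coefficient vectors: supported on `A` and nonnegative off `σ`. -/
def admissibleWeights {E : Type*} (A : Set E) (σ : Finset E) : Set (E →₀ ℝ) :=
  {a | (∀ q, q ∉ A → a q = 0) ∧ ∀ q, q ∉ σ → 0 ≤ a q}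

theorem convex_admissibleWeights {E : Type*} (A : Set E) (σ : Finset E) :
    Convex ℝ (admissibleWeights A σ) := by
  rintro a ⟨ha1, ha2⟩ b ⟨hb1, hb2⟩ s t hs ht -
  refine ⟨fun q hq => by simp [ha1 q hq, hb1 q hq], fun q hq => ?_⟩
  have := ha2 q hq
  have := hb2 q hq
  simp only [Finsupp.add_apply, Finsupp.smul_apply, smul_eq_mul]
  positivity

section WeakDelaunay

variable {E : Type*} [NormedAddCommGroup E] [InnerProductSpace ℝ E]

/-- The points whose distance to each point of `T` is at most the distance to each point
of `A`. For `T ⊆ A` this is the Voronoi face dual to `T`. -/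
def voronoiFace (A T : Set E) : Set E :=
  {x | ∀ s ∈ T, ∀ q ∈ A, ‖x - s‖ ≤ ‖x - q‖}

/-- The lift of a point to a paraboloid, in homogeneous coordinates. -/
def paraboloidLift (q : E) : ℝ × E × ℝ := (1, q, ‖q‖ ^ 2)

/-- The functional whose value at `paraboloidLift q` is `‖w - q‖ ^ 2 - c ^ 2`. -/
def powerFunctional (w : E) (c : ℝ) : (ℝ × E × ℝ) →ₗ[ℝ] ℝ where
  toFun y := y.2.2 - 2 * ⟪w, y.2.1⟫ + (‖w‖ ^ 2 - c ^ 2) * y.1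
  map_add' y z := by simp [inner_add_right]; ring
  map_smul' t y := by simp [inner_smul_right]; ring

theorem continuous_powerFunctional (w : E) (c : ℝ) : Continuous (powerFunctional w c) := by
  change Continuous fun y : ℝ × E × ℝ => y.2.2 - 2 * ⟪w, y.2.1⟫ + (‖w‖ ^ 2 - c ^ 2) * y.1
  fun_prop

theorem powerFunctional_paraboloidLift (w q : E) (c : ℝ) :
    powerFunctional w c (paraboloidLift q) = ‖w - q‖ ^ 2 - c ^ 2 := by
  rw [norm_sub_sq_real]
  simp [powerFunctional, paraboloidLift]
  ring

/-- De Silva's weak witness theorem: if every face of `σ` has a weak witness, then `σ` has a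
strong witness. -/
theorem voronoiFace_nonempty_of_witnesses [CompleteSpace E] {A : Set E} {σ : Finset E}
    (hσA : (σ : Set E) ⊆ A)
    (hw : ∀ τ ⊆ σ, τ.Nonempty →
      ∃ (w : E) (c : ℝ), (∀ t ∈ τ, ‖w - t‖ ≤ c) ∧ ∀ q ∈ A, q ∉ τ → c ≤ ‖w - q‖) :
    (voronoiFace A (σ : Set E)).Nonempty := by
  classical
  have hw' : ∀ τ ⊆ σ, ∃ (w : E) (c : ℝ), 0 ≤ c ∧
      (∀ t ∈ τ, ‖w - t‖ ≤ c) ∧ ∀ q ∈ A, q ∉ τ → c ≤ ‖w - q‖ := by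
    intro τ hτ
    rcases τ.eq_empty_or_nonempty with rfl | hne
    -- The empty face needs a functional too: radius `0` serves.
    · exact ⟨0, 0, le_rfl, by simp, fun q _ _ => norm_nonneg _⟩
    · obtain ⟨w, c, h1, h2⟩ := hw τ hτ hne
      obtain ⟨t, ht⟩ := hne
      exact ⟨w, c, (norm_nonneg _).trans (h1 t ht), h1, h2⟩
  choose! w c hc hwτ hwq using hw'
  let u : E → ℝ × E × ℝ := paraboloidLift
  let C : Set (ℝ × E × ℝ) := Finsupp.linearCombination ℝ u '' admissibleWeights A σ
  have hCconv : Convex ℝ C := (convex_admissibleWeights A σ).linear_image _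
  let e : ℝ × E × ℝ := (0, 0, -1)
  -- For a given combination, the face of its negative coefficients has a power functional whose
  -- sign agrees with every coefficient, so the combination has nonnegative value there.
  have hsub : C ⊆ ⋃ τ ∈ σ.powerset, {y | 0 ≤ powerFunctional (w τ) (c τ) y} := by
    rintro _ ⟨a, ⟨ha1, ha2⟩, rfl⟩
    let τ := σ.filter fun q => a q < 0
    have hτ : τ ⊆ σ := Finset.filter_subset _ _
    simp only [Set.mem_iUnion]
    refine ⟨τ, Finset.mem_powerset.2 hτ, ?_⟩
    rw [Set.mem_ofPred_eq, Finsupp.linearCombination_apply, Finsupp.sum, map_sum]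
    refine Finset.sum_nonneg fun q hq => ?_
    have hqA : q ∈ A := by
      by_contra h
      exact Finsupp.mem_support_iff.1 hq (ha1 q h)
    rw [map_smul, smul_eq_mul, powerFunctional_paraboloidLift]
    by_cases hqτ : q ∈ τ
    · have h1 := hwτ τ hτ q hqτ
      have h2 := (Finset.mem_filter.1 hqτ).2
      have h3 := pow_le_pow_left₀ (norm_nonneg _) h1 2
      exact mul_nonneg_of_nonpos_of_nonpos h2.le (by linarith)
    · have h1 := hwq τ hτ q hqA hqτ
      have h2 : 0 ≤ a q := by
        by_contra! h
        by_cases hqσ : q ∈ σ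
        · exact hqτ (Finset.mem_filter.2 ⟨hqσ, h⟩)
        · exact absurd (ha2 q hqσ) (not_le.2 h)
      have h3 := pow_le_pow_left₀ (hc τ hτ) h1 2
      exact mul_nonneg h2 (by linarith)
  have hclosed : IsClosed (⋃ τ ∈ σ.powerset, {y | 0 ≤ powerFunctional (w τ) (c τ) y}) :=
    σ.powerset.finite_toSet.isClosed_biUnion fun τ _ =>
      isClosed_le continuous_const (continuous_powerFunctional _ _)
  -- Every power functional takes the value `-1` at `e`.
  have he : e ∉ closure C := by
    intro h
    have := closure_minimal hsub hclosed h
    simp only [Set.mem_iUnion] at this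
    obtain ⟨τ, -, h⟩ := this
    norm_num [e, powerFunctional] at h
  obtain ⟨f, k, hfe, hfC⟩ := geometric_hahn_banach_point_closed hCconv.closure isClosed_closure he
  have hmem : ∀ a ∈ admissibleWeights A σ, k < f (Finsupp.linearCombination ℝ u a) :=
    fun a ha => hfC _ (subset_closure ⟨a, ha, rfl⟩)
  have hk : k < 0 := by
    simpa using hmem 0 ⟨fun _ _ => rfl, fun _ _ => le_rfl⟩
  -- On a ray in `C`, a negative slope would let `f` reach `k`. For vertices of `σ` both signs of
  -- coefficient are allowed, hence the opposite inequality in `hneg`.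
  have hfu : ∀ q, (∀ t : ℝ, 0 ≤ t → Finsupp.single q t ∈ admissibleWeights A σ) →
      0 ≤ f (u q) := by
    intro q hq
    by_contra! h
    have := hmem _ (hq (k / f (u q)) (div_nonneg_of_nonpos hk.le h.le))
    rw [Finsupp.linearCombination_single, map_smul, smul_eq_mul, div_mul_cancel₀ _ h.ne] at this
    exact lt_irrefl _ this
  have hpos : ∀ q ∈ A, 0 ≤ f (u q) := fun q hq => hfu q fun t ht => by
    refine ⟨fun r hr => ?_, fun r _ => ?_⟩
    · exact Finsupp.single_eq_of_ne (by rintro rfl; exact hr hq)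
    · rw [Finsupp.single_apply]; split_ifs <;> simp [ht]
  have hneg : ∀ p ∈ σ, f (u p) ≤ 0 := by
    intro p hp
    by_contra! h
    have hadm : Finsupp.single p (k / f (u p)) ∈ admissibleWeights A σ := by
      refine ⟨fun r hr => ?_, fun r hr => ?_⟩
      · exact Finsupp.single_eq_of_ne (by rintro rfl; exact hr (hσA hp))
      · rw [Finsupp.single_eq_of_ne (by rintro rfl; exact hr hp)]
    have := hmem _ hadm
    rw [Finsupp.linearCombination_single, map_smul, smul_eq_mul, div_mul_cancel₀ _ h.ne'] at this
    exact lt_irrefl _ this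
  let β : ℝ := f (0, 0, 1)
  let α : ℝ := f (1, 0, 0)
  have hβ : 0 < β := by
    have : f e = -β := by
      rw [← map_neg]; simp [e]
    linarith
  let g : StrongDual ℝ E := f.comp ((ContinuousLinearMap.inr ℝ ℝ (E × ℝ)).comp
    (ContinuousLinearMap.inl ℝ E ℝ))
  obtain ⟨ξ, hξ⟩ := (InnerProductSpace.toDual ℝ E).surjective g
  have hfq : ∀ q, f (u q) = α + ⟪ξ, q⟫ + β * ‖q‖ ^ 2 := by
    intro q
    have h1 : u q = (1, 0, 0) + (0, q, 0) + (‖q‖ ^ 2) • (0, 0, 1) := by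
      simp [u, paraboloidLift]
    have h2 : ⟪ξ, q⟫ = f (0, q, 0) := by
      rw [← InnerProductSpace.toDual_apply_apply, hξ]; simp [g]
    rw [h1, map_add, map_add, map_smul, h2, smul_eq_mul, mul_comm β]
  -- Completing the square: `f (u q)` is a positive multiple of the squared distance to `x`, up to a
  -- constant.
  let x : E := -(2 * β)⁻¹ • ξ
  have hx : ∀ q, β * ‖x - q‖ ^ 2 = β * ‖x‖ ^ 2 - α + f (u q) := by
    intro q
    rw [norm_sub_sq_real, hfq]
    simp only [x, inner_smul_left, inner_neg_left, neg_smul]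
    simp
    field_simp
    ring
  refine ⟨x, fun p hp q hq => ?_⟩
  have h1 := hx p
  have h2 := hx q
  have h3 := hneg p hp
  have h4 := hpos q hq
  refine le_of_sq_le_sq ?_ (norm_nonneg _)
  exact le_of_mul_le_mul_left (by linarith) hβ

end WeakDelaunay

/-! ### Witness simplices are Delaunay -/

namespace FlatTorus

variable {d : ℕ}

/-- The quotient norm is attained on lifts. -/
theorem exists_lift_norm_sub_eq (x : EuclideanSpace ℝ (Fin d)) (y : FlatTorus d) :
    ∃ y', proj y' = y ∧ ‖x - y'‖ = ‖proj x - y‖ := by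
  obtain ⟨y₀, hy₀⟩ := proj_surjective y
  have hfin := finite_lifts_inter_closedBall {y} x ‖x - y₀‖
  obtain ⟨y', ⟨hy', hb⟩, hmin⟩ := Set.exists_min_image _ (fun z => ‖x - z‖) hfin
    ⟨y₀, by simp [mem_lifts, hy₀], by rw [mem_closedBall_iff_norm, norm_sub_rev]⟩
  have hy : proj y' = y := by simpa [mem_lifts] using hy'
  refine ⟨y', hy, le_antisymm (le_norm_proj_sub fun z hz => ?_) (hy ▸ norm_proj_sub_le x y')⟩
  by_cases hz' : ‖x - z‖ ≤ ‖x - y₀‖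
  · exact hmin z ⟨by simp [mem_lifts, hz], by rwa [mem_closedBall_iff_norm, norm_sub_rev]⟩
  · rw [mem_closedBall_iff_norm, norm_sub_rev] at hb
    linarith

theorem continuous_norm_proj_sub (y : FlatTorus d) :
    Continuous fun x : EuclideanSpace ℝ (Fin d) => ‖proj x - y‖ := by
  refine (LipschitzWith.of_le_add fun a b => ?_).continuous
  rw [dist_eq_norm]
  linarith [norm_sub_le_norm_sub_add_norm_sub (proj a) (proj b) y, norm_proj_sub_le a b]

/-- Slide from `w` towards `q` until `p` and `q` are equidistant. The ball about the new center
through `q` lies inside the ball about `w` through `q`, so its interior contains no landmark and its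
radius is below `lam`. -/
theorem norm_sub_lt_of_isWitness_pair_of_le {L : Finset (FlatTorus d)} {lam : ℝ}
    (hL : IsSample (L : Set (FlatTorus d)) lam) {p q w : FlatTorus d}
    (hw : ∀ r ∈ L, r ≠ p → r ≠ q → ‖w - q‖ ≤ ‖w - r‖) (hpq : ‖w - p‖ ≤ ‖w - q‖) :
    ‖p - q‖ < 2 * lam := by
  obtain ⟨w, rfl⟩ := proj_surjective w
  obtain ⟨q', rfl, hq'⟩ := exists_lift_norm_sub_eq w q
  let γ : ℝ → EuclideanSpace ℝ (Fin d) := fun t => w + t • (q' - w)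
  have hγ : Continuous γ := by fun_prop
  obtain ⟨t, ⟨ht0, ht1⟩, ht⟩ : ∃ t ∈ Set.Icc (0 : ℝ) 1,
      ‖proj (γ t) - p‖ - ‖proj (γ t) - proj q'‖ = 0 := by
    have hcont : ContinuousOn (fun t => ‖proj (γ t) - p‖ - ‖proj (γ t) - proj q'‖)
        (Set.Icc 0 1) :=
      (((continuous_norm_proj_sub p).comp hγ).sub
        ((continuous_norm_proj_sub (proj q')).comp hγ)).continuousOn
    refine intermediate_value_Icc zero_le_one hcont ⟨?_, ?_⟩
    · simpa [γ] using hpq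
    · simp [γ]
  have h1 : ‖γ t - q'‖ = (1 - t) * ‖w - q'‖ := by
    rw [show γ t - q' = (1 - t) • (w - q') by simp only [γ]; module, norm_smul, Real.norm_eq_abs,
      abs_of_nonneg (by linarith)]
  have h2 : ‖w - γ t‖ = t * ‖w - q'‖ := by
    rw [show w - γ t = t • (w - q') by simp only [γ]; module, norm_smul, Real.norm_eq_abs,
      abs_of_nonneg ht0]
  have hx : ‖proj (γ t) - proj q'‖ < lam := by
    obtain ⟨r, hr, hlt⟩ := hL (proj (γ t))
    rw [norm_sub_rev] at hlt
    by_cases hrp : r = p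
    · rw [hrp] at hlt; linarith
    by_cases hrq : r = proj q'
    · rwa [hrq] at hlt
    have h3 := hw r hr hrp hrq
    have h4 := norm_sub_le_norm_sub_add_norm_sub (proj w) (proj (γ t)) r
    have h5 := norm_proj_sub_le w (γ t)
    have h6 := norm_proj_sub_le (γ t) q'
    nlinarith
  have h7 := norm_sub_le_norm_sub_add_norm_sub p (proj (γ t)) (proj q')
  rw [norm_sub_rev p (proj (γ t))] at h7
  linarith

/-- Edges of the witness complex have length less than `2 * lam`. -/
theorem norm_sub_lt_of_isWitness_pair [DecidableEq (FlatTorus d)] {L : Finset (FlatTorus d)}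
    {lam : ℝ} (hL : IsSample (L : Set (FlatTorus d)) lam) {p q w : FlatTorus d}
    (hw : IsWitness L {p, q} w) : ‖p - q‖ < 2 * lam := by
  rcases le_total ‖w - p‖ ‖w - q‖ with h | h
  · exact norm_sub_lt_of_isWitness_pair_of_le hL
      (fun r hr h1 h2 => hw q (by simp) r hr (by simp [h1, h2])) h
  · rw [norm_sub_rev]
    exact norm_sub_lt_of_isWitness_pair_of_le hL
      (fun r hr h1 h2 => hw p (by simp) r hr (by simp [h1, h2])) h

theorem isDelaunayCenter_of_mem_voronoiFace {L σ : Finset (FlatTorus d)}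
    {T : Set (EuclideanSpace ℝ (Fin d))} (hT : ∀ p ∈ σ, ∃ t ∈ T, proj t = p)
    {x : EuclideanSpace ℝ (Fin d)} (hx : x ∈ voronoiFace (lifts L) T) :
    IsDelaunayCenter L σ (proj x) := by
  intro p hp q hq
  obtain ⟨t, ht, rfl⟩ := hT p hp
  rw [norm_sub_rev, norm_sub_rev q]
  refine le_norm_proj_sub fun q' hq' => (norm_proj_sub_le x t).trans (hx t ht q' ?_)
  rwa [mem_lifts, hq']

theorem witnessComplex_subset_delaunayComplex {L : Finset (FlatTorus d)}
    {W : Set (FlatTorus d)} {lam : ℝ} (hlam : lam ≤ 1 / 6)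
    (hL : IsSample (L : Set (FlatTorus d)) lam) :
    witnessComplex L W ⊆ delaunayComplex L := by
  classical
  rintro σ ⟨hne, hσL, hwit⟩
  refine ⟨hne, hσL, ?_⟩
  have hedge : ∀ s ∈ σ, ∀ t ∈ σ, ‖s - t‖ < 2 * lam := by
    intro s hs t ht
    obtain ⟨w, -, hw⟩ := hwit {s, t} (by simp) (by simp [Finset.insert_subset_iff, hs, ht])
    exact norm_sub_lt_of_isWitness_pair hL hw
  obtain ⟨p, hp⟩ := hne
  obtain ⟨p', rfl⟩ := proj_surjective p
  have hlift : ∀ s ∈ σ, ∃ s', proj s' = s ∧ ‖s' - p'‖ < 2 * lam :=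
    fun s hs => exists_lift_of_norm_sub_lt (hedge s hs _ hp)
  choose! g hgproj hgp using hlift
  have hg : ∀ s ∈ σ, ∀ t ∈ σ, ‖g s - g t‖ < 2 * lam := by
    intro s hs t ht
    have h := hedge s hs t ht
    rw [← hgproj t ht] at h
    obtain ⟨s', hs', hlt⟩ := exists_lift_of_norm_sub_lt h
    -- Three steps of length below `2 * lam` join the two lifts; this uses `6 * lam ≤ 1`.
    have : s' = g s := by
      refine eq_of_proj_eq (hs'.trans (hgproj s hs).symm) ?_
      have h1 := norm_sub_le_norm_sub_add_norm_sub s' (g t) (g s)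
      have h2 := norm_sub_le_norm_sub_add_norm_sub (g t) p' (g s)
      have h3 := hgp s hs
      have h4 := hgp t ht
      rw [norm_sub_rev] at h3
      linarith
    rwa [this] at hlt
  obtain ⟨x, hx⟩ : (voronoiFace (lifts L) (σ.image g : Set (EuclideanSpace ℝ (Fin d)))).Nonempty := by
    refine voronoiFace_nonempty_of_witnesses ?_ ?_
    · intro y hy
      obtain ⟨s, hs, rfl⟩ := Finset.mem_image.1 (Finset.mem_coe.1 hy)
      rw [mem_lifts, hgproj s hs]
      exact hσL hs
    intro τ' hτ' hτne
    obtain ⟨τ, hτ, rfl⟩ := Finset.subset_image_iff.1 hτ'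
    obtain ⟨w, -, hw⟩ := hwit τ (by simpa using hτne) hτ
    obtain ⟨s, hs, hws⟩ : ∃ s ∈ τ, ‖w - s‖ < lam := by
      obtain ⟨r, hr, hlt⟩ := hL w
      rw [norm_sub_rev] at hlt
      by_cases hrτ : r ∈ τ
      · exact ⟨r, hrτ, hlt⟩
      · obtain ⟨t, ht⟩ : τ.Nonempty := by simpa using hτne
        exact ⟨t, ht, (hw t ht r hr hrτ).trans_lt hlt⟩
    rw [← hgproj s (hτ hs)] at hws
    obtain ⟨w, rfl, hlt⟩ := exists_lift_of_norm_sub_lt hws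
    have hnear : ∀ t ∈ τ, ‖w - g t‖ ≤ 1 / 2 := by
      intro t ht
      have h1 := norm_sub_le_norm_sub_add_norm_sub w (g s) (g t)
      have h2 := hg s (hτ hs) t (hτ ht)
      linarith
    obtain ⟨t₀, ht₀, hmax⟩ := Finset.exists_max_image τ (fun t => ‖w - g t‖) ⟨s, hs⟩
    refine ⟨w, ‖w - g t₀‖, ?_, ?_⟩
    · intro t ht
      obtain ⟨s, hs, rfl⟩ := Finset.mem_image.1 ht
      exact hmax s hs
    · intro q hq hqτ
      by_cases hpq : proj q ∈ τ
      -- Another lift of a vertex of `τ` is at distance at least `1` from the chosen one, hence at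
      -- least `1 / 2` from `w`.
      · have hne : q ≠ g (proj q) := fun h => hqτ (Finset.mem_image.2 ⟨_, hpq, h.symm⟩)
        have h1 := one_le_norm_sub (hgproj _ (hτ hpq)).symm hne
        have h2 := norm_sub_le_norm_sub_add_norm_sub q w (g (proj q))
        rw [norm_sub_rev q w] at h2
        linarith [hnear _ hpq, hnear _ ht₀]
      · have h1 := hw t₀ ht₀ _ hq hpq
        have h2 := norm_proj_sub_eq (hnear _ ht₀)
        rw [hgproj _ (hτ ht₀)] at h2
        rw [← h2]
        exact h1.trans (norm_proj_sub_le _ _)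
  exact ⟨proj x, isDelaunayCenter_of_mem_voronoiFace
    (fun s hs => ⟨g s, by simpa using ⟨s, hs, rfl⟩, hgproj s hs⟩) hx⟩

end FlatTorus

/-! ### Voronoi faces and their extreme points -/

section VoronoiFace

variable {E : Type*} [NormedAddCommGroup E]

theorem isClosed_setOf_norm_sub_le_norm_sub (s q : E) : IsClosed {x | ‖x - s‖ ≤ ‖x - q‖} :=
  isClosed_le (by fun_prop) (by fun_prop)

theorem voronoiFace_eq_iInter (A T : Set E) :
    voronoiFace A T = ⋂ s ∈ T, ⋂ q ∈ A, {x | ‖x - s‖ ≤ ‖x - q‖} := by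
  ext x
  simp [voronoiFace]

theorem isClosed_voronoiFace (A T : Set E) : IsClosed (voronoiFace A T) := by
  rw [voronoiFace_eq_iInter]
  exact isClosed_biInter fun s _ => isClosed_biInter fun q _ =>
    isClosed_setOf_norm_sub_le_norm_sub s q

theorem norm_sub_lt_of_mem_voronoiFace {A T : Set E} {lam : ℝ}
    (hA : ∀ x, ∃ a ∈ A, ‖a - x‖ < lam) {x v : E} (hx : x ∈ voronoiFace A T) (hv : v ∈ T) :
    ‖x - v‖ < lam := by
  obtain ⟨a, ha, hlt⟩ := hA x
  rw [norm_sub_rev] at hlt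
  exact (hx v hv a ha).trans_lt hlt

theorem exists_gap {A : Set E} (hfin : ∀ x r, (A ∩ Metric.closedBall x r).Finite) (c : E)
    (R : ℝ) : ∃ η > 0, ∀ q ∈ A, R < ‖c - q‖ → R + η ≤ ‖c - q‖ := by
  let F := (A ∩ Metric.closedBall c (R + 1)) ∩ {q | R < ‖c - q‖}
  have hF : F.Finite := (hfin c (R + 1)).subset Set.inter_subset_left
  rcases F.eq_empty_or_nonempty with h | h
  · refine ⟨1, one_pos, fun q hq hR => ?_⟩
    by_contra! hlt
    have : q ∈ F := ⟨⟨hq, by rw [mem_closedBall_iff_norm, norm_sub_rev]; exact hlt.le⟩, hR⟩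
    simp [h] at this
  · obtain ⟨q₀, ⟨-, hq₀⟩, hmin⟩ := Set.exists_min_image F (fun q => ‖c - q‖) hF h
    refine ⟨min 1 (‖c - q₀‖ - R), lt_min one_pos (sub_pos.2 hq₀), fun q hq hR => ?_⟩
    by_cases hle : ‖c - q‖ ≤ R + 1
    · have := hmin q ⟨⟨hq, by rwa [mem_closedBall_iff_norm, norm_sub_rev]⟩, hR⟩
      linarith [min_le_right 1 (‖c - q₀‖ - R)]
    · linarith [min_le_left 1 (‖c - q₀‖ - R)]

variable [InnerProductSpace ℝ E]

theorem norm_sub_le_norm_sub_iff_inner (x s q : E) :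
    ‖x - s‖ ≤ ‖x - q‖ ↔ ⟪q - s, x⟫ ≤ (‖q‖ ^ 2 - ‖s‖ ^ 2) / 2 := by
  rw [← sq_le_sq₀ (norm_nonneg _) (norm_nonneg _), norm_sub_sq_real, norm_sub_sq_real,
    inner_sub_left, real_inner_comm x s, real_inner_comm x q]
  constructor <;> intro h <;> linarith

theorem convex_setOf_norm_sub_le_norm_sub (s q : E) : Convex ℝ {x | ‖x - s‖ ≤ ‖x - q‖} := by
  simp_rw [norm_sub_le_norm_sub_iff_inner]
  exact convex_halfSpace_le (innerₛₗ ℝ (q - s)).isLinear _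

theorem convex_voronoiFace (A T : Set E) : Convex ℝ (voronoiFace A T) := by
  rw [voronoiFace_eq_iInter]
  exact convex_iInter₂ fun s _ => convex_iInter₂ fun q _ => convex_setOf_norm_sub_le_norm_sub s q

theorem isCompact_voronoiFace [FiniteDimensional ℝ E] {A T : Set E} {lam : ℝ}
    (hA : ∀ x, ∃ a ∈ A, ‖a - x‖ < lam) (hT : T.Nonempty) : IsCompact (voronoiFace A T) := by
  obtain ⟨v, hv⟩ := hT
  have := FiniteDimensional.proper_real E
  refine (isCompact_closedBall v lam).of_isClosed_subset (isClosed_voronoiFace A T) fun x hx => ?_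
  rw [mem_closedBall_iff_norm]
  exact (norm_sub_lt_of_mem_voronoiFace hA hx hv).le

theorem norm_add_smul_sub_sq_sub (c u q v : E) (t : ℝ) :
    ‖c + t • u - q‖ ^ 2 - ‖c + t • u - v‖ ^ 2 =
      ‖c - q‖ ^ 2 - ‖c - v‖ ^ 2 - 2 * t * ⟪u, q - v⟫ := by
  have h : ∀ z : E, ‖c + t • u - z‖ ^ 2 =
      ‖c - z‖ ^ 2 + 2 * t * (⟪u, c⟫ - ⟪u, z⟫) + ‖t • u‖ ^ 2 := by
    intro z
    rw [show c + t • u - z = (c - z) + t • u by abel, norm_add_sq_real, inner_smul_right,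
      real_inner_comm, inner_sub_right]
    ring
  rw [h, h, inner_sub_right]
  ring

/-- One can move from `c` inside a Voronoi face in any direction that is orthogonal to the face
and does not approach the other nearest points. -/
theorem exists_add_smul_mem_voronoiFace {A T : Set E}
    (hfin : ∀ x r, (A ∩ Metric.closedBall x r).Finite) (hTA : T ⊆ A) {c v u : E}
    (hc : c ∈ voronoiFace A T) (hv : v ∈ T)
    (hu : ∀ q ∈ A, ‖c - q‖ ≤ ‖c - v‖ → ⟪u, q - v⟫ ≤ 0) (huT : ∀ s ∈ T, ⟪u, s - v⟫ = 0) :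
    ∃ t₀ > (0 : ℝ), ∀ t, 0 ≤ t → t ≤ t₀ → c + t • u ∈ voronoiFace A T := by
  obtain ⟨η, hη, hgap⟩ := exists_gap hfin c ‖c - v‖
  have hu1 : 0 < 2 * (‖u‖ + 1) := by positivity
  -- Distances change by at most `η / 2`, so points beyond the gap cannot overtake `v`; the `+ 1`
  -- covers `u = 0`.
  refine ⟨η / (2 * (‖u‖ + 1)), by positivity, fun t ht ht₀ s hs q hq => ?_⟩
  have htu : 2 * (t * ‖u‖) ≤ η := by
    rw [le_div_iff₀ hu1] at ht₀
    nlinarith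
  have hnorm : ‖t • u‖ = t * ‖u‖ := by rw [norm_smul, Real.norm_eq_abs, abs_of_nonneg ht]
  have hsv : ‖c + t • u - s‖ ^ 2 = ‖c + t • u - v‖ ^ 2 := by
    have h1 := norm_add_smul_sub_sq_sub c u s v t
    rw [huT s hs, le_antisymm (hc s hs v (hTA hv)) (hc v hv s (hTA hs))] at h1
    linarith
  rw [← sq_le_sq₀ (norm_nonneg _) (norm_nonneg _), hsv]
  by_cases hle : ‖c - q‖ ≤ ‖c - v‖
  · have h1 := norm_add_smul_sub_sq_sub c u q v t
    rw [le_antisymm hle (hc v hv q hq)] at h1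
    have h2 := mul_nonneg ht (neg_nonneg.2 (hu q hq hle))
    linarith
  · have h1 := hgap q hq (not_le.1 hle)
    have h2 : ‖c + t • u - v‖ ≤ ‖c - v‖ + t * ‖u‖ := by
      rw [show c + t • u - v = (c - v) + t • u by abel, ← hnorm]
      exact norm_add_le _ _
    have h3 : ‖c - q‖ ≤ ‖c + t • u - q‖ + t * ‖u‖ := by
      rw [show c - q = (c + t • u - q) - t • u by abel, ← hnorm]
      exact norm_sub_le _ _
    exact pow_le_pow_left₀ (norm_nonneg _) (by linarith) 2

/-- At an extreme point of a Voronoi face the nearest points span the whole space. -/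
theorem span_sub_eq_top_of_mem_extremePoints [FiniteDimensional ℝ E] {A T : Set E}
    (hfin : ∀ x r, (A ∩ Metric.closedBall x r).Finite) (hTA : T ⊆ A) {c v : E}
    (hc : c ∈ (voronoiFace A T).extremePoints ℝ) (hv : v ∈ T) :
    Submodule.span ℝ ((fun q => q - v) '' {q ∈ A | ‖c - q‖ ≤ ‖c - v‖}) = ⊤ := by
  by_contra hK
  rw [← Submodule.orthogonal_eq_bot_iff] at hK
  obtain ⟨u, hu, hu0⟩ := Submodule.exists_mem_ne_zero_of_ne_bot hK
  have hcV := hc.1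
  have horth : ∀ q ∈ A, ‖c - q‖ ≤ ‖c - v‖ → ⟪u, q - v⟫ = 0 := fun q hq hle => by
    rw [real_inner_comm]
    exact hu _ (Submodule.subset_span ⟨q, ⟨hq, hle⟩, rfl⟩)
  have hT : ∀ s ∈ T, ⟪u, s - v⟫ = 0 := fun s hs => horth s (hTA hs) (hcV s hs v (hTA hv))
  obtain ⟨t₁, ht₁, h₁⟩ := exists_add_smul_mem_voronoiFace hfin hTA hcV hv
    (fun q hq hle => (horth q hq hle).le) hT
  obtain ⟨t₂, ht₂, h₂⟩ := exists_add_smul_mem_voronoiFace (u := -u) hfin hTA hcV hv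
    (fun q hq hle => by rw [inner_neg_left, horth q hq hle, neg_zero])
    (fun s hs => by rw [inner_neg_left, hT s hs, neg_zero])
  have ht : 0 < min t₁ t₂ := lt_min ht₁ ht₂
  -- Moving both ways along `u` stays in the face, against extremality.
  have hmid : c ∈ openSegment ℝ (c + min t₁ t₂ • u) (c + min t₁ t₂ • -u) :=
    ⟨1 / 2, 1 / 2, by norm_num, by norm_num, by norm_num, by module⟩
  have := hc.2 (h₁ _ ht.le (min_le_left _ _)) (h₂ _ ht.le (min_le_right _ _)) hmid
  rw [add_eq_left, smul_eq_zero] at this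
  exact this.elim ht.ne' hu0

/-- A finite set whose differences with `v` span contains an affine basis through `v`; each other
element of that basis is separated from the rest by a linear functional. -/
theorem exists_affine_basis_subset [FiniteDimensional ℝ E] {N : Set E} {v : E} (hv : v ∈ N)
    (hspan : Submodule.span ℝ ((fun q => q - v) '' N) = ⊤) :
    ∃ S : Finset E, (S : Set E) ⊆ N ∧ v ∈ S ∧ S.card = Module.finrank ℝ E + 1 ∧
      Submodule.span ℝ ((fun q => q - v) '' (S : Set E)) = ⊤ ∧
      ∀ s ∈ S, s ≠ v → ∃ u : E, ⟪u, s - v⟫ < 0 ∧ ∀ q ∈ S, q ≠ s → ⟪u, q - v⟫ = 0 := by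
  classical
  obtain ⟨b, hbN, hbspan, hb⟩ := exists_linearIndependent ℝ ((fun q => q - v) '' N)
  rw [hspan] at hbspan
  have hbfin : b.Finite := hb.setFinite
  have h0 : (0 : E) ∉ b := fun h => hb.ne_zero ⟨0, h⟩ rfl
  have := hbfin.fintype
  have hcard : b.toFinset.card = Module.finrank ℝ E := by
    rw [← finrank_span_set_eq_card hb, hbspan, finrank_top]
  let S := insert v (b.toFinset.image (· + v))
  have hS : ∀ q, q ∈ S ↔ q = v ∨ q - v ∈ b := by
    intro q
    simp [S, sub_eq_add_neg]
  refine ⟨S, ?_, by simp [S], ?_, ?_, ?_⟩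
  · intro q hq
    rcases (hS q).1 (Finset.mem_coe.1 hq) with rfl | h
    · exact hv
    · obtain ⟨r, hr, hrq⟩ := hbN h
      rwa [← sub_left_injective hrq]
  · rw [Finset.card_insert_of_notMem, Finset.card_image_of_injective _ (add_left_injective v),
      hcard]
    simp [h0]
  · refine top_unique (hbspan ▸ Submodule.span_mono fun y hy => ⟨y + v, ?_, by simp⟩)
    exact Finset.mem_coe.2 ((hS _).2 (Or.inr (by simpa using hy)))
  · intro s hs hsv
    have hsb : s - v ∈ b := ((hS s).1 hs).resolve_left hsv
    let K := Submodule.span ℝ (b \ {s - v})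
    have hK : s - v ∉ K := by
      have := hb.notMem_span_image (s := {⟨s - v, hsb⟩}ᶜ) (x := ⟨s - v, hsb⟩) (by simp)
      rwa [Set.image_compl_eq_range_sdiff_image Subtype.val_injective, Subtype.range_coe,
        Set.image_singleton] at this
    have hK' : s - v ∉ Kᗮᗮ := by rwa [Submodule.orthogonal_orthogonal]
    obtain ⟨u, hu, hne⟩ : ∃ u ∈ Kᗮ, ⟪u, s - v⟫ ≠ 0 := by
      by_contra! h
      exact hK' fun u hu => h u hu
    have hzero : ∀ q ∈ S, q ≠ s → ⟪u, q - v⟫ = 0 := by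
      intro q hq hqs
      rcases (hS q).1 hq with rfl | h
      · simp
      · rw [real_inner_comm]
        exact hu _ (Submodule.subset_span ⟨h, fun h' => hqs (sub_left_injective h')⟩)
    rcases lt_or_gt_of_ne hne with h | h
    · exact ⟨u, h, hzero⟩
    · exact ⟨-u, by simpa using h, fun q hq hqs => by simp [hzero q hq hqs]⟩

/-- A bisector half-space containing all extreme points of a compact convex set contains
the set. -/
theorem exists_mem_extremePoints_norm_sub_lt {V : Set E} (hV : IsCompact V) (hconv : Convex ℝ V)
    {x s v : E} (hx : x ∈ V) (hlt : ‖x - v‖ < ‖x - s‖) :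
    ∃ c ∈ V.extremePoints ℝ, ‖c - v‖ < ‖c - s‖ := by
  by_contra! h
  rw [← closure_convexHull_extremePoints hV hconv] at hx
  have hsub := closure_minimal (convexHull_min (fun c hc => h c hc)
    (convex_setOf_norm_sub_le_norm_sub s v)) (isClosed_setOf_norm_sub_le_norm_sub s v)
  exact absurd (hsub hx) (not_le.2 hlt)

/-! ### Averaging protected centers -/

theorem norm_average_sub_sq_sub {ι : Type*} {I : Finset ι} (hI : I.Nonempty) (c : ι → E)
    (q v : E) :
    I.card * (‖(I.card : ℝ)⁻¹ • ∑ i ∈ I, c i - q‖ ^ 2 -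
      ‖(I.card : ℝ)⁻¹ • ∑ i ∈ I, c i - v‖ ^ 2) =
      ∑ i ∈ I, (‖c i - q‖ ^ 2 - ‖c i - v‖ ^ 2) := by
  have h : ∀ y : E, ‖y - q‖ ^ 2 - ‖y - v‖ ^ 2 = 2 * ⟪y, v - q⟫ + (‖q‖ ^ 2 - ‖v‖ ^ 2) := by
    intro y
    rw [norm_sub_sq_real, norm_sub_sq_real, inner_sub_right]
    ring
  have h0 : (I.card : ℝ) ≠ 0 := by exact_mod_cast hI.card_ne_zero
  simp_rw [h]
  rw [Finset.sum_add_distrib, ← Finset.mul_sum, ← sum_inner, Finset.sum_const, nsmul_eq_mul,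
    real_inner_smul_left]
  field_simp

theorem norm_average_sub_le {ι : Type*} {I : Finset ι} (hI : I.Nonempty) (c : ι → E) (v : E) :
    I.card * ‖(I.card : ℝ)⁻¹ • ∑ i ∈ I, c i - v‖ ≤ ∑ i ∈ I, ‖c i - v‖ := by
  have h0 : (I.card : ℝ) ≠ 0 := by exact_mod_cast hI.card_ne_zero
  have h : (I.card : ℝ) • ((I.card : ℝ)⁻¹ • ∑ i ∈ I, c i - v) = ∑ i ∈ I, (c i - v) := by
    rw [Finset.sum_sub_distrib, Finset.sum_const, smul_sub, smul_inv_smul₀ h0,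
      Nat.cast_smul_eq_nsmul]
  calc (I.card : ℝ) * ‖(I.card : ℝ)⁻¹ • ∑ i ∈ I, c i - v‖
      = ‖∑ i ∈ I, (c i - v)‖ := by rw [← h, norm_smul, Real.norm_natCast]
    _ ≤ _ := norm_sum_le _ _

/-- The average of `n + 1` centers, one of which is `δ`-protected against `q`, is
`2 * ε`-protected against `q`. -/
theorem norm_average_sub_add_le {ι : Type*} {I : Finset ι} {n : ℕ} (hn : 1 ≤ n)
    (hI : I.card = n + 1) {c : ι → E} {v q : E} {lam mu δ ε : ℝ} (hε : 0 < ε) (hmu : 0 < mu)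
    (hmu2 : mu < 2) (hδ : 8 * n * ε ≤ δ * mu) (hlam : ∀ i ∈ I, ‖c i - v‖ < lam)
    (hle : ∀ i ∈ I, ‖c i - v‖ ≤ ‖c i - q‖) (hsep : mu * lam ≤ ‖v - q‖) {j : ι} (hj : j ∈ I)
    (hprot : ‖c j - v‖ + δ < ‖c j - q‖) :
    ‖(I.card : ℝ)⁻¹ • ∑ i ∈ I, c i - v‖ + 2 * ε ≤ ‖(I.card : ℝ)⁻¹ • ∑ i ∈ I, c i - q‖ := by
  classical
  have hsq := norm_average_sub_sq_sub ⟨j, hj⟩ c q v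
  have hav := norm_average_sub_le ⟨j, hj⟩ c v
  set x := (I.card : ℝ)⁻¹ • ∑ i ∈ I, c i
  have hI' : (I.card : ℝ) = n + 1 := by rw [hI]; push_cast; ring
  rw [hI'] at hsq hav
  have hn' : (1 : ℝ) ≤ n := by exact_mod_cast hn
  have hδ0 : 0 < δ := by
    by_contra! h
    have : 0 < 8 * n * ε := by positivity
    nlinarith
  have hδ4 : 4 * n * ε ≤ δ := by nlinarith
  have h1 : ‖c j - q‖ ^ 2 - ‖c j - v‖ ^ 2 ≤ ∑ i ∈ I, (‖c i - q‖ ^ 2 - ‖c i - v‖ ^ 2) :=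
    Finset.single_le_sum (f := fun i => ‖c i - q‖ ^ 2 - ‖c i - v‖ ^ 2)
      (fun i hi => sub_nonneg.2 (pow_le_pow_left₀ (norm_nonneg _) (hle i hi) 2)) hj
  have h2 : ∑ i ∈ I, ‖c i - v‖ ≤ ‖c j - v‖ + n * lam := by
    rw [← Finset.add_sum_erase I _ hj]
    gcongr
    calc ∑ i ∈ I.erase j, ‖c i - v‖ ≤ ∑ i ∈ I.erase j, lam :=
          Finset.sum_le_sum fun i hi => (hlam i (Finset.mem_of_mem_erase hi)).le
      _ = n * lam := by rw [Finset.sum_const, Finset.card_erase_of_mem hj, hI]; simp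
  have h3 : mu * lam ≤ ‖c j - q‖ + ‖c j - v‖ := by
    have := norm_sub_le_norm_sub_add_norm_sub v (c j) q
    rw [norm_sub_rev v (c j)] at this
    linarith
  have h4 : δ * (‖c j - q‖ + ‖c j - v‖) ≤ (n + 1) * (‖x - q‖ ^ 2 - ‖x - v‖ ^ 2) := by
    rw [hsq]
    refine le_trans ?_ h1
    rw [sq_sub_sq, mul_comm]
    exact mul_le_mul_of_nonneg_left (by linarith) (by positivity)
  -- If `‖x - v‖ + ε ≤ lam`, separation suffices. Otherwise `‖x - v‖` is nearly `lam`, which forces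
  -- `‖c j - v‖ ≥ ‖x - v‖ - n * ε`, and `δ ≥ 4 * n * ε` makes up the loss.
  have h5 : 8 * n * ε * (‖x - v‖ + ε) ≤ δ * (‖c j - q‖ + ‖c j - v‖) := by
    by_cases hr : ‖x - v‖ + ε ≤ lam
    · calc 8 * n * ε * (‖x - v‖ + ε) ≤ (δ * mu) * lam := by gcongr
        _ = δ * (mu * lam) := by ring
        _ ≤ _ := by gcongr
    · have h6 : n * (lam - ‖x - v‖) ≤ n * ε := by gcongr; linarith
      have h7 : ε ≤ n * ε := le_mul_of_one_le_left hε.le hn'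
      calc 8 * n * ε * (‖x - v‖ + ε) = (4 * n * ε) * (2 * (‖x - v‖ + ε)) := by ring
        _ ≤ δ * (‖c j - q‖ + ‖c j - v‖) := by gcongr; nlinarith
  -- Here `8 * n ≥ 4 * (n + 1)`, as `n ≥ 1`.
  have h8 : 4 * ε * (‖x - v‖ + ε) ≤ ‖x - q‖ ^ 2 - ‖x - v‖ ^ 2 := by
    have h9 : 0 < ε * (‖x - v‖ + ε) := by positivity
    refine le_of_mul_le_mul_left ?_ (by positivity : (0 : ℝ) < n + 1)
    nlinarith
  exact le_of_sq_le_sq (by linarith) (norm_nonneg _)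

end VoronoiFace

/-! ### Protected centers for faces of Delaunay simplices -/

namespace FlatTorus

variable {d : ℕ}

/-- At an extreme point `c` of a Voronoi face, protection of the `d`-simplices forces the nearest
points to form an affinely independent `d`-simplex that is protected at `c`. -/
theorem exists_nearest_simplex_of_mem_extremePoints {L : Finset (FlatTorus d)} {lam δ : ℝ}
    (hlam : lam ≤ 1 / 4) (hL : IsSample (L : Set (FlatTorus d)) lam) (hδ : 0 < δ)
    {T : Set (EuclideanSpace ℝ (Fin d))} (hTL : T ⊆ lifts L) {v c : EuclideanSpace ℝ (Fin d)}
    (hv : v ∈ T)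
    (hprot : ∀ σ ∈ delaunayComplex L, proj v ∈ σ → σ.card = d + 1 → IsProtected L σ δ)
    (hc : c ∈ (voronoiFace (lifts L) T).extremePoints ℝ) :
    ∃ N : Finset (EuclideanSpace ℝ (Fin d)), N.card = d + 1 ∧
      (∀ q, q ∈ N ↔ q ∈ lifts L ∧ ‖c - q‖ ≤ ‖c - v‖) ∧
      (∀ s ∈ N, s ≠ v → ∃ u : EuclideanSpace ℝ (Fin d), ⟪u, s - v⟫ < 0 ∧
        ∀ q ∈ N, q ≠ s → ⟪u, q - v⟫ = 0) ∧
      ∀ q ∈ lifts L, (∀ s ∈ N, proj s ≠ proj q) → ‖c - v‖ + δ < ‖c - q‖ := by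
  classical
  have hcv : ‖c - v‖ < lam :=
    norm_sub_lt_of_mem_voronoiFace (exists_mem_lifts_norm_sub_lt hL) hc.1 hv
  obtain ⟨S, hSN, hvS, hcard, hspan, hu⟩ := exists_affine_basis_subset
    (N := {q ∈ lifts L | ‖c - q‖ ≤ ‖c - v‖}) (v := v) ⟨hTL hv, le_rfl⟩
    (span_sub_eq_top_of_mem_extremePoints (finite_lifts_inter_closedBall L) hTL hc hv)
  rw [finrank_euclideanSpace_fin] at hcard
  have hnear : ∀ q s, ‖c - q‖ ≤ ‖c - v‖ → ‖c - s‖ ≤ ‖c - v‖ → ‖q - s‖ < 2 * lam := by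
    intro q s hq hs
    have := norm_sub_le_norm_sub_add_norm_sub q c s
    rw [norm_sub_rev q c] at this
    linarith
  have hinj : Set.InjOn proj (S : Set (EuclideanSpace ℝ (Fin d))) := fun q hq s hs h =>
    eq_of_proj_eq h (by linarith [hnear q s (hSN hq).2 (hSN hs).2])
  let σ := S.image proj
  have hσ : σ ∈ delaunayComplex L := by
    refine ⟨⟨proj v, Finset.mem_image_of_mem _ hvS⟩, ?_, proj c,
      isDelaunayCenter_of_mem_voronoiFace (T := S) (fun p hp => ?_) fun s hs q hq => ?_⟩
    · intro p hp
      obtain ⟨s, hs, rfl⟩ := Finset.mem_image.1 hp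
      exact (hSN hs).1
    · obtain ⟨s, hs, rfl⟩ := Finset.mem_image.1 hp
      exact ⟨s, hs, rfl⟩
    · exact (hSN hs).2.trans (hc.1 v hv q hq)
  have hvσ : proj v ∈ σ := Finset.mem_image_of_mem _ hvS
  obtain ⟨y, hy, hyprot⟩ := hprot σ hσ hvσ (by rw [Finset.card_image_of_injOn hinj, hcard])
  have hyv : ‖proj v - y‖ < lam := by
    obtain ⟨r, hr, hlt⟩ := hL y
    exact (hy _ hvσ r hr).trans_lt hlt
  obtain ⟨y, rfl, hyv'⟩ := exists_lift_of_norm_sub_lt (by rwa [norm_sub_rev] at hyv)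
  have hdist : ∀ s ∈ S, ‖proj s - proj y‖ = ‖s - y‖ := by
    intro s hs
    have h1 := (hy _ (Finset.mem_image_of_mem _ hs) _ (hTL hv)).trans_lt hyv
    obtain ⟨s', hs', hlt⟩ := exists_lift_of_norm_sub_lt h1
    -- The two lifts are less than `4 * lam ≤ 1` apart.
    have : s' = s := by
      refine eq_of_proj_eq hs' ?_
      have h2 := norm_sub_le_norm_sub_add_norm_sub s' y s
      have h3 := norm_sub_le_norm_sub_add_norm_sub y v s
      have h4 := hnear v s le_rfl (hSN hs).2
      linarith
    rw [this] at hlt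
    exact norm_proj_sub_eq (by linarith)
  -- Both points are equidistant from the spanning set `S`, so their difference is orthogonal to
  -- everything.
  have hyc : y = c := by
    have horth : y - c ∈ (Submodule.span ℝ
        ((fun q => q - v) '' (S : Set (EuclideanSpace ℝ (Fin d)))))ᗮ := by
      rw [Submodule.mem_orthogonal']
      intro z hz
      induction hz using Submodule.span_induction with
      | mem z hz =>
        obtain ⟨s, hs, rfl⟩ := hz
        have h1 : ‖y - s‖ = ‖y - v‖ := by
          rw [norm_sub_rev, ← hdist s hs, norm_sub_rev y, ← hdist v hvS]
          have hsσ := Finset.mem_image_of_mem proj hs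
          exact le_antisymm (hy _ hsσ _ (hTL hv)) (hy _ hvσ _ (hSN hs).1)
        have h2 : ‖c - s‖ = ‖c - v‖ := le_antisymm (hSN hs).2 (hc.1 v hv s (hSN hs).1)
        have h3 := norm_add_smul_sub_sq_sub c (y - c) s v 1
        rw [one_smul, add_sub_cancel, h1, h2] at h3
        linarith
      | zero => simp
      | add a b _ _ ha hb => rw [inner_add_right, ha, hb, add_zero]
      | smul t a _ ha => rw [inner_smul_right, ha, mul_zero]
    rw [hspan, Submodule.top_orthogonal_eq_bot, Submodule.mem_bot] at horth
    exact sub_eq_zero.1 horth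
  subst hyc
  have hfar : ∀ q ∈ lifts L, (∀ s ∈ S, proj s ≠ proj q) → ‖y - v‖ + δ < ‖y - q‖ := by
    intro q hq hne
    have h1 := hyprot _ hvσ _ hq (by simpa [σ] using hne)
    rw [norm_proj_sub_eq (by linarith)] at h1
    exact h1.trans_le (norm_proj_sub_le _ _)
  refine ⟨S, hcard, fun q => ⟨fun hq => hSN hq, fun ⟨hq, hle⟩ => ?_⟩, hu, hfar⟩
  by_contra hqS
  have h1 := hfar q hq fun s hs h => by
    have := eq_of_proj_eq h (by linarith [hnear s q (hSN hs).2 hle])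
    exact hqS (this ▸ hs)
  linarith

/-- If the Delaunay `d`-simplices at a vertex of `τ` are `δ`-protected, then `τ` is
`2 * ε`-protected. -/
theorem exists_protected_center {L : Finset (FlatTorus d)} {lam mu δ ε : ℝ} (hd : 1 ≤ d)
    (hlam : lam ≤ 1 / 4) (hmu : 0 < mu) (hL : IsNet L lam mu) (hε : 0 < ε)
    (hδ : 8 * (d : ℝ) * ε ≤ δ * mu) {τ : Finset (FlatTorus d)} (hτ : τ ∈ delaunayComplex L)
    {p : FlatTorus d} (hp : p ∈ τ)
    (hprot : ∀ σ ∈ delaunayComplex L, p ∈ σ → σ.card = d + 1 → IsProtected L σ δ) :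
    ∃ x, ∀ t ∈ τ, ∀ q ∈ L, q ∉ τ → ‖x - t‖ + 2 * ε ≤ ‖x - q‖ := by
  classical
  obtain ⟨-, hτL, x₀, hx₀⟩ := hτ
  obtain ⟨x₀, rfl⟩ := proj_surjective x₀
  have hd' : (1 : ℝ) ≤ d := by exact_mod_cast hd
  have hδ0 : 0 < δ := by
    by_contra! h
    have : 0 < 8 * (d : ℝ) * ε := by positivity
    nlinarith
  have hlift : ∀ t ∈ τ, ∃ t', proj t' = t ∧ ‖t' - x₀‖ < lam := by
    intro t ht
    obtain ⟨r, hr, hlt⟩ := hL.sample (proj x₀)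
    exact exists_lift_of_norm_sub_lt ((hx₀ t ht r hr).trans_lt hlt)
  choose! g hgproj hgx using hlift
  let T : Set (EuclideanSpace ℝ (Fin d)) := g '' τ
  have hTL : T ⊆ lifts L := by
    rintro _ ⟨t, ht, rfl⟩
    rw [mem_lifts, hgproj t ht]
    exact hτL ht
  let v := g p
  have hv : v ∈ T := ⟨p, hp, rfl⟩
  have hvp : proj v = p := hgproj p hp
  let V := voronoiFace (lifts L) T
  have hx₀V : x₀ ∈ V := by
    rintro _ ⟨t, ht, rfl⟩ q hq
    have h1 := hx₀ t ht _ hq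
    rw [← hgproj t ht, norm_proj_sub_eq (by linarith [hgx t ht]), norm_sub_rev] at h1
    refine h1.trans ?_
    rw [norm_sub_rev x₀]
    exact norm_proj_sub_le _ _
  have hdense := exists_mem_lifts_norm_sub_lt hL.sample
  have hcomp : IsCompact V := isCompact_voronoiFace hdense ⟨v, hv⟩
  have hconv : Convex ℝ V := convex_voronoiFace _ _
  have hVv : ∀ x ∈ V, ‖x - v‖ < lam := fun x hx => norm_sub_lt_of_mem_voronoiFace hdense hx hv
  rw [← hvp] at hprot
  have hext := fun c (hc : c ∈ V.extremePoints ℝ) =>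
    exists_nearest_simplex_of_mem_extremePoints hlam hL.sample hδ0 hTL hv hprot hc
  obtain ⟨c₀, hc₀⟩ := hcomp.extremePoints_nonempty ⟨x₀, hx₀V⟩
  obtain ⟨N, hNcard, hN, hNu, hNfar⟩ := hext c₀ hc₀
  have hTN : ∀ t ∈ T, t ∈ N := fun t ht =>
    (hN t).2 ⟨hTL ht, hc₀.1 t ht v (hTL hv)⟩
  -- As `d ≥ 1`, `N` has a second point, less than `2 * lam` from `v`.
  have hmu2 : mu < 2 := by
    obtain ⟨s, hs, hsv⟩ := Finset.exists_mem_ne (by omega : 1 < N.card) v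
    have h1 := ((hN s).1 hs).2
    have h2 := hVv c₀ hc₀.1
    have h3 := norm_sub_le_norm_sub_add_norm_sub s c₀ v
    rw [norm_sub_rev s c₀] at h3
    have hne : proj s ≠ proj v := fun h => hsv (eq_of_proj_eq h (by linarith))
    have h4 := hL.separated _ ((hN s).1 hs).1 _ (hTL hv) hne
    have h5 := norm_proj_sub_le s v
    have h6 : 0 < lam := (norm_nonneg _).trans_lt h2
    by_contra! h
    nlinarith
  have hchoice : ∀ s ∈ N, ∃ c ∈ V.extremePoints ℝ, s ∉ T → ‖c - v‖ < ‖c - s‖ := by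
    intro s hs
    by_cases hsT : s ∈ T
    · exact ⟨c₀, hc₀, fun h => absurd hsT h⟩
    have hsv : s ≠ v := fun h => hsT (h ▸ hv)
    obtain ⟨u, hus, hu⟩ := hNu s hs hsv
    obtain ⟨t, ht, hmem⟩ := exists_add_smul_mem_voronoiFace (u := u)
      (finite_lifts_inter_closedBall L) hTL hc₀.1 hv
      (fun q hq hle => by
        by_cases hqs : q = s
        · rw [hqs]; exact hus.le
        · exact (hu q ((hN q).2 ⟨hq, hle⟩) hqs).le)
      (fun q hq => hu q (hTN q hq) fun h => hsT (h ▸ hq))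
    -- Moving along `u` leaves `s` behind while staying in `V`; an extreme point with the same
    -- strict inequality then exists.
    have hlt : ‖c₀ + t • u - v‖ < ‖c₀ + t • u - s‖ := by
      have h1 := norm_add_smul_sub_sq_sub c₀ u s v t
      have h2 := pow_le_pow_left₀ (norm_nonneg _) (hc₀.1 v hv s ((hN s).1 hs).1) 2
      have h3 := mul_neg_of_pos_of_neg ht hus
      exact lt_of_pow_lt_pow_left₀ 2 (norm_nonneg _) (by linarith)
    obtain ⟨c, hc, hcs⟩ := exists_mem_extremePoints_norm_sub_lt hcomp hconv
      (hmem t ht.le le_rfl) hlt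
    exact ⟨c, hc, fun _ => hcs⟩
  choose! c hcV hcs using hchoice
  -- Indices in `T` are all sent to `c₀`, so that `c₀` occurs in the average.
  let c' := fun s => if s ∈ T then c₀ else c s
  have hc'V : ∀ s ∈ N, c' s ∈ V.extremePoints ℝ := by
    intro s hs
    simp only [c']
    split_ifs
    exacts [hc₀, hcV s hs]
  have hexists : ∀ q ∈ lifts L, proj q ∉ τ → ∃ s ∈ N, ‖c' s - v‖ + δ < ‖c' s - q‖ := by
    intro q hq hqτ
    by_cases h : ∀ s ∈ N, proj s ≠ proj q
    · exact ⟨v, hTN v hv, by simpa [c', hv] using hNfar q hq h⟩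
    push Not at h
    obtain ⟨s, hs, hsq⟩ := h
    have hsT : s ∉ T := by
      rintro ⟨t, ht, rfl⟩
      rw [hgproj t ht] at hsq
      exact hqτ (hsq ▸ ht)
    obtain ⟨M, -, hM, -, hMfar⟩ := hext (c s) (hcV s hs)
    refine ⟨s, hs, ?_⟩
    simp only [c', if_neg hsT]
    refine hMfar q hq fun r hr hrq => ?_
    -- The path `r`, `c s`, `v`, `c₀`, `s` has four legs shorter than `lam`. So `s` would be nearest
    -- at `c s`, against its choice.
    have hrs : r = s := by
      refine eq_of_proj_eq (hrq.trans hsq.symm) ?_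
      have h1 := norm_sub_le_norm_sub_add_norm_sub r (c s) v
      have h2 := norm_sub_le_norm_sub_add_norm_sub v c₀ s
      have h3 := norm_sub_le_norm_sub_add_norm_sub r v s
      have h4 := ((hM r).1 hr).2
      have h5 := ((hN s).1 hs).2
      have h6 := hVv _ (hcV s hs).1
      have h7 := hVv _ hc₀.1
      rw [norm_sub_rev r (c s)] at h1
      rw [norm_sub_rev v c₀] at h2
      linarith
    have h1 := hcs s hs hsT
    have h2 := ((hM r).1 hr).2
    rw [hrs] at h2
    linarith
  let x := (N.card : ℝ)⁻¹ • ∑ s ∈ N, c' s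
  have hxV : x ∈ V := by
    have h0 : (N.card : ℝ) ≠ 0 := by rw [hNcard]; positivity
    have : x = ∑ s ∈ N, (N.card : ℝ)⁻¹ • c' s := by rw [← Finset.smul_sum]
    rw [this]
    refine hconv.sum_mem (fun _ _ => by positivity) ?_ fun s hs => (hc'V s hs).1
    rw [Finset.sum_const, nsmul_eq_mul, mul_inv_cancel₀ h0]
  refine ⟨proj x, fun t ht q hq hqτ => le_norm_proj_sub fun q' hq' => ?_⟩
  have hqL : q' ∈ lifts L := by rwa [mem_lifts, hq']
  have hqτ' : proj q' ∉ τ := by rwa [hq']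
  obtain ⟨j, hj, hjq⟩ := hexists q' hqL hqτ'
  have hsep : mu * lam ≤ ‖v - q'‖ := by
    refine (hL.separated (proj v) (hTL hv) (proj q') hqL fun h => hqτ' ?_).trans
      (norm_proj_sub_le _ _)
    rwa [← h, hvp]
  have hmain := norm_average_sub_add_le hd hNcard hε hmu hmu2 hδ
    (fun s hs => hVv _ (hc'V s hs).1) (fun s hs => (hc'V s hs).1 v hv q' hqL) hsep hj hjq
  have h1 := norm_proj_sub_le x (g t)
  rw [hgproj t ht] at h1
  have h2 := hxV (g t) ⟨t, ht, rfl⟩ v (hTL hv)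
  linarith

theorem exists_isWitness_of_protected_center {L τ : Finset (FlatTorus d)}
    {W : Set (FlatTorus d)} {ε : ℝ} (hW : IsSample W ε) {x : FlatTorus d}
    (hx : ∀ t ∈ τ, ∀ q ∈ L, q ∉ τ → ‖x - t‖ + 2 * ε ≤ ‖x - q‖) : ∃ w ∈ W, IsWitness L τ w := by
  obtain ⟨w, hwW, hw⟩ := hW x
  refine ⟨w, hwW, fun t ht q hq hqτ => ?_⟩
  have h1 := hx t ht q hq hqτ
  have h2 := norm_sub_le_norm_sub_add_norm_sub w x t
  have h3 := norm_sub_le_norm_sub_add_norm_sub x w q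
  rw [norm_sub_rev x w] at h3
  linarith

theorem mem_delaunayComplex_of_subset {L σ τ : Finset (FlatTorus d)}
    (hσ : σ ∈ delaunayComplex L) (hne : τ.Nonempty) (hτσ : τ ⊆ σ) : τ ∈ delaunayComplex L := by
  obtain ⟨-, hσL, x, hx⟩ := hσ
  exact ⟨hne, hτσ.trans hσL, x, fun p hp q hq => hx p (hτσ hp) q hq⟩

theorem mem_vertexStar {p : FlatTorus d} {X : Set (Finset (FlatTorus d))}
    {σ : Finset (FlatTorus d)} : σ ∈ vertexStar p X ↔ σ ∈ X ∧ p ∈ σ := by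
  simp [vertexStar, star]

instance : Subsingleton (FlatTorus 0) :=
  (proj_surjective (d := 0)).subsingleton

end FlatTorus

theorem mainTheorem3 (d : ℕ) (L : Finset (FlatTorus d)) (W : Set (FlatTorus d))
    (lam mu δ ε : ℝ) (hlam : lam ≤ 1 / 4) (hmu : 0 < mu)
    (hL : FlatTorus.IsNet L lam mu) (p : FlatTorus d) (hp : p ∈ L)
    (hprot : ∀ σ ∈ FlatTorus.star2 L p, σ.card = d + 1 → FlatTorus.IsProtected L σ δ)
    (hW : FlatTorus.IsSample W ε) (hδ : 8 * (d : ℝ) * ε / mu ≤ δ) :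
    FlatTorus.vertexStar p (FlatTorus.delaunayComplex L) ⊆
        FlatTorus.vertexStar p (FlatTorus.witnessComplex L W) ∧
      (lam ≤ 1 / 6 →
        FlatTorus.vertexStar p (FlatTorus.witnessComplex L W) =
          FlatTorus.vertexStar p (FlatTorus.delaunayComplex L)) := by
  have hsub : FlatTorus.vertexStar p (FlatTorus.delaunayComplex L) ⊆
      FlatTorus.vertexStar p (FlatTorus.witnessComplex L W) := by
    intro σ hσ
    obtain ⟨hσD, hpσ⟩ := FlatTorus.mem_vertexStar.1 hσ
    refine FlatTorus.mem_vertexStar.2 ⟨⟨hσD.1, hσD.2.1, fun τ hne hτσ => ?_⟩, hpσ⟩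
    obtain ⟨v, hv⟩ := hne
    -- For `d = 0` the torus is a point and no landmark lies outside `τ`.
    rcases Nat.eq_zero_or_pos d with rfl | hd
    · obtain ⟨w, hw, -⟩ := hW 0
      exact ⟨w, hw, fun t _ q _ hq => absurd (Subsingleton.elim v q ▸ hv) hq⟩
    have hε : 0 < ε := by
      obtain ⟨w, -, hw⟩ := hW 0
      exact (norm_nonneg _).trans_lt hw
    obtain ⟨x, hx⟩ := FlatTorus.exists_protected_center hd hlam hmu hL hε
      ((div_le_iff₀ hmu).1 hδ) (FlatTorus.mem_delaunayComplex_of_subset hσD ⟨v, hv⟩ hτσ) hv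
      fun ρ hρ hvρ hcard => hprot ρ ⟨hρ, v, hvρ, σ, hσ, hτσ hv⟩ hcard
    exact FlatTorus.exists_isWitness_of_protected_center hW hx
  refine ⟨hsub, fun hlam6 => Set.Subset.antisymm (fun σ hσ => ?_) hsub⟩
  obtain ⟨hσW, hpσ⟩ := FlatTorus.mem_vertexStar.1 hσ
  exact FlatTorus.mem_vertexStar.2
    ⟨FlatTorus.witnessComplex_subset_delaunayComplex hlam6 hL.sample hσW, hpσ⟩
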